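/- Let $d \ge 0$ be an integer, let $k=\lfloor d/2\rfloor$, and let $P$ be a polynomial with complex coefficients, of degree exactly $d$, such that $P(e^{i\theta})=\overline{P(e^{-i\theta})}$ for all real $\theta$. Suppose that all $d$ zeros of $P$, counted with multiplicity, lie on the unit circle and are given by $e^{it_1},e^{-it_1},\dots,e^{it_k},e^{-it_k}$, together with one further zero $-1$ if $d$ is odd, where $0<t_1\le t_2\le\dots\le t_k\le\pi$. Put $t_0=0$ and $t_{k+1}=\pi$. Then for every $0<q<\infty$ the integrands below are integrable and \[ |P(1)|^q=\sum_{n=0}^{k}\int_{t_n}^{t_{n+1}}|P(e^{i\theta})|^q\,\frac{\sin\left(\left(\frac{d}{2}q+\frac12\right)\theta-\pi q n\right)}{\sin\frac{\theta}{2}}\,\frac{d\theta}{\pi}. \] -/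

import Mathlib

/-!
With `a` running over the zeros of `P`, the function `F z = ‖lc P‖ ^ q * ∏ (1 - conj a * z) ^ q` is
holomorphic in the unit disc, and on the circle it has modulus `‖P z‖ ^ q` and argument
`q * ∑ arg (1 - conj a * z)`. Along the upper half circle that sum is linear in `θ` with slope
`d / 2`, except that it drops by `π` whenever `θ` passes one of the `t j`; this is the phase in the
integrand. The identity itself is the mean value property of `2 * z * (F z - F 1) / (z - 1)`, which
vanishes at `0`: since `z - 1 = 2 * I * sin (θ / 2) * exp (θ / 2 * I)` at `z = exp (θ * I)`, its
real part there is `Im (F z * exp (θ / 2 * I)) / sin (θ / 2) - F 1`, and invariance under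
conjugation reduces the mean to the upper half circle.
-/

section

open Complex MeasureTheory Metric Set
open scoped ComplexConjugate Real

theorem exp_ofReal_mul_I_sub_one (θ : ℝ) :
    exp (θ * I) - 1 = 2 * I * Real.sin (θ / 2) * exp ((θ / 2 : ℝ) * I) := by
  have hsq : exp (θ * I) = exp ((θ / 2 : ℝ) * I) * exp ((θ / 2 : ℝ) * I) := by
    rw [← exp_add]; push_cast; ring_nf
  have hpyth : (Real.cos (θ / 2) : ℂ) ^ 2 + (Real.sin (θ / 2) : ℂ) ^ 2 = 1 := by
    exact_mod_cast Real.cos_sq_add_sin_sq (θ / 2)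
  rw [hsq, exp_mul_I, ← ofReal_cos, ← ofReal_sin]
  linear_combination hpyth - (Real.sin (θ / 2) : ℂ) ^ 2 * I_sq

theorem sin_half_pos {θ : ℝ} (hθ : θ ∈ Ioo 0 (2 * π)) : 0 < Real.sin (θ / 2) :=
  Real.sin_pos_of_pos_of_lt_pi (by linarith [hθ.1]) (by linarith [hθ.2])

variable {f : ℂ → ℂ}

theorem integral_zero_pi_re_comp_exp (hf : DiffContOnCl ℂ f (ball 0 1))
    (hre : ∀ z : ℂ, ‖z‖ = 1 → (f (conj z)).re = (f z).re) :
    ∫ θ in (0 : ℝ)..π, (f (exp (θ * I))).re = π * (f 0).re := by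
  set g : ℝ → ℝ := fun θ => (f (exp (θ * I))).re with hg
  have hfcont : Continuous fun θ : ℝ => f (exp (θ * I)) :=
    hf.continuousOn_ball.comp_continuous (by fun_prop) fun θ => by simp [norm_exp_ofReal_mul_I]
  have hgint (a b : ℝ) : IntervalIntegrable g volume a b :=
    (continuous_re.comp hfcont).intervalIntegrable a b
  have heven (θ : ℝ) : g (-θ) = g θ := by
    have hexp : exp ((-θ : ℝ) * I) = conj (exp (θ * I)) := by simp [← exp_conj]
    simp only [hg, hexp, hre _ (norm_exp_ofReal_mul_I θ)]
  have hleft : ∫ θ in (-π)..0, g θ = ∫ θ in (0 : ℝ)..π, g θ := by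
    rw [← neg_zero, ← intervalIntegral.integral_comp_neg, neg_zero]
    simp only [heven]
  have hmean : (2 * π)⁻¹ * ∫ θ in (-π)..π, g θ = (f 0).re := by
    have hav : Real.circleAverage f 0 1 = f 0 := DiffContOnCl.circleAverage (by simpa using hf)
    rw [Real.circleAverage_eq_integral_add (-π),
      intervalIntegral.integral_comp_add_right (fun θ => f (circleMap 0 1 θ))] at hav
    rw [← hav, show 0 + -π = -π by ring, show 2 * π + -π = π by ring, real_smul, re_ofReal_mul]
    congr 1
    simpa [circleMap, hg] using reCLM.intervalIntegral_comp_comm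
      (hfcont.intervalIntegrable (μ := volume) (-π) π)
  rw [← intervalIntegral.integral_add_adjacent_intervals (hgint (-π) 0) (hgint 0 π), hleft] at hmean
  have := Real.pi_ne_zero
  field_simp at hmean
  linarith

theorem im_mul_exp_half_div_sin_half (hf1 : (f 1).im = 0) {θ : ℝ} (hθ : Real.sin (θ / 2) ≠ 0) :
    (f (exp (θ * I)) * exp ((θ / 2 : ℝ) * I)).im / Real.sin (θ / 2) =
      (f 1).re + (2 * exp (θ * I) * dslope f 1 (exp (θ * I))).re := by
  set z := exp (θ * I) with hz
  set w := exp ((θ / 2 : ℝ) * I) with hw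
  have hzw : z = w * w := by rw [hz, hw, ← exp_add]; push_cast; ring_nf
  have hf1' : f 1 = ((f 1).re : ℂ) := Complex.ext rfl (by simpa using hf1)
  have hsplit : f z * w =
      (f 1).re * w + (Real.sin (θ / 2) : ℝ) * (I * (2 * z * dslope f 1 z)) := by
    have hslope : (z - 1) * dslope f 1 z = f z - f 1 := sub_smul_dslope f 1 z
    rw [hz, exp_ofReal_mul_I_sub_one, ← hz, ← hw] at hslope
    rw [← hf1']
    linear_combination -w * hslope - 2 * I * Real.sin (θ / 2) * dslope f 1 z * hzw
  rw [hsplit, add_im, im_ofReal_mul, im_ofReal_mul, I_mul_im, hw, exp_ofReal_mul_I_im]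
  field_simp

theorem diffContOnCl_two_mul_dslope_one (hf : DiffContOnCl ℂ f (ball 0 1))
    (hf1 : DifferentiableAt ℂ f 1) :
    DiffContOnCl ℂ (fun z => 2 * z * dslope f 1 z) (ball 0 1) := by
  refine .mk_ball (fun z hz => ?_) (.mul (by fun_prop) fun z hz => ?_)
  · have hne : z ≠ 1 := by rintro rfl; simp at hz
    have := (differentiableAt_dslope_of_ne hne).2 (hf.differentiableAt isOpen_ball hz)
    exact DifferentiableAt.differentiableWithinAt (by fun_prop)
  · rcases eq_or_ne z 1 with rfl | hne
    · exact (continuousAt_dslope_same.2 hf1).continuousWithinAt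
    · exact (continuousWithinAt_dslope_of_ne hne).2 (hf.continuousOn_ball z hz)

theorem two_mul_dslope_one_conj_re (hconj : ∀ z : ℂ, ‖z‖ = 1 → f (conj z) = conj (f z)) {z : ℂ}
    (hz : ‖z‖ = 1) :
    (2 * conj z * dslope f 1 (conj z)).re = (2 * z * dslope f 1 z).re := by
  rcases eq_or_ne z 1 with rfl | hne
  · simp
  · have hne' : conj z ≠ 1 := (map_ne_one_iff _ (star_injective (R := ℂ))).2 hne
    have hf1 : conj (f 1) = f 1 := by simpa using (hconj 1 norm_one).symm
    rw [← conj_re (2 * z * _)]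
    simp only [dslope_of_ne _ hne, dslope_of_ne _ hne', slope_def_field, map_mul, map_div₀,
      map_sub, map_one, map_ofNat, hconj z hz, hf1]

theorem intervalIntegrable_and_integral_im_mul_exp_half_div_sin_half
    (hf : DiffContOnCl ℂ f (ball 0 1)) (hf1 : DifferentiableAt ℂ f 1)
    (hconj : ∀ z : ℂ, ‖z‖ = 1 → f (conj z) = conj (f z)) :
    IntervalIntegrable (fun θ : ℝ =>
        (f (exp (θ * I)) * exp ((θ / 2 : ℝ) * I)).im / Real.sin (θ / 2))
      volume 0 π ∧
    ∫ θ in (0 : ℝ)..π, (f (exp (θ * I)) * exp ((θ / 2 : ℝ) * I)).im / Real.sin (θ / 2) =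
      π * (f 1).re := by
  set g : ℝ → ℝ := fun θ => (2 * exp (θ * I) * dslope f 1 (exp (θ * I))).re
  have hslope := diffContOnCl_two_mul_dslope_one hf hf1
  have hg : Continuous g := continuous_re.comp <|
    hslope.continuousOn_ball.comp_continuous (by fun_prop) fun θ => by
      simp [norm_exp_ofReal_mul_I]
  have hgint : ∫ θ in (0 : ℝ)..π, g θ = 0 := by
    have := integral_zero_pi_re_comp_exp hslope fun z => two_mul_dslope_one_conj_re hconj
    rwa [mul_zero, zero_mul, zero_re, mul_zero] at this
  have hf1im : (f 1).im = 0 := conj_eq_iff_im.1 (by simpa using (hconj 1 norm_one).symm)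
  have hEq : EqOn (fun θ => (f 1).re + g θ) (fun θ : ℝ =>
      (f (exp (θ * I)) * exp ((θ / 2 : ℝ) * I)).im / Real.sin (θ / 2)) (Ioo 0 π) := fun θ hθ =>
    (im_mul_exp_half_div_sin_half hf1im
      (sin_half_pos ⟨hθ.1, by linarith [hθ.1, hθ.2]⟩).ne').symm
  constructor
  · refine ((hg.const_add (f 1).re).intervalIntegrable 0 π).congr_uIoo ?_
    rwa [uIoo_of_le Real.pi_pos.le]
  · rw [← intervalIntegral.integral_congr_Ioo_of_le Real.pi_pos.le hEq,
      intervalIntegral.integral_add intervalIntegrable_const (hg.intervalIntegrable _ _), hgint]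
    simp

theorem one_sub_re_nonneg {w : ℂ} (hw : ‖w‖ ≤ 1) : 0 ≤ (1 - w).re := by
  simpa using (re_le_norm w).trans hw

theorem one_sub_re_pos {w : ℂ} (hw : ‖w‖ ≤ 1) (hne : w ≠ 1) : 0 < (1 - w).re := by
  refine (one_sub_re_nonneg hw).lt_of_ne' fun h => hne ?_
  have hre : w.re = 1 := by rw [sub_re, one_re] at h; linarith
  have him : w.im = 0 := by
    have hsq : ‖w‖ ^ 2 ≤ 1 := pow_le_one₀ (norm_nonneg w) hw
    rw [Complex.sq_norm, normSq_apply, hre] at hsq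
    nlinarith [sq_nonneg w.im]
  exact Complex.ext hre him

theorem norm_conj_mul_le_one {a z : ℂ} (ha : ‖a‖ ≤ 1) (hz : ‖z‖ ≤ 1) : ‖conj a * z‖ ≤ 1 := by
  simpa using mul_le_one₀ ha (norm_nonneg z) hz

theorem arg_one_sub_exp_of_pos {φ : ℝ} (hφ : φ ∈ Ioo 0 (2 * π)) :
    (1 - exp (φ * I)).arg = (φ - π) / 2 := by
  have hpolar : 1 - exp (φ * I) = (2 * Real.sin (φ / 2) : ℝ) * exp (((φ - π) / 2 : ℝ) * I) := by
    have hexp : exp (((φ - π) / 2 : ℝ) * I) = -I * exp ((φ / 2 : ℝ) * I) := by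
      rw [← exp_neg_pi_div_two_mul_I, ← exp_add]
      push_cast
      ring_nf
    rw [hexp, ofReal_mul, ofReal_ofNat]
    linear_combination -exp_ofReal_mul_I_sub_one φ
  rw [hpolar, exp_mul_I, ← ofReal_cos, ← ofReal_sin]
  exact_mod_cast arg_mul_cos_add_sin_mul_I (mul_pos two_pos (sin_half_pos hφ))
    ⟨by linarith [hφ.1, Real.pi_pos], by linarith [hφ.2, Real.pi_pos]⟩

theorem arg_one_sub_exp_of_neg {φ : ℝ} (hφ : φ ∈ Ioo (-(2 * π)) 0) :
    (1 - exp (φ * I)).arg = (φ + π) / 2 := by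
  have hperiod : exp (φ * I) = exp ((φ + 2 * π : ℝ) * I) := by
    push_cast
    rw [add_mul, exp_add, exp_two_pi_mul_I, mul_one]
  rw [hperiod, arg_one_sub_exp_of_pos ⟨by linarith [hφ.1], by linarith [hφ.2]⟩]
  ring

theorem prod_map_cpow_ofReal (s : Multiset ℂ) (q : ℝ) :
    (s.map fun x => x ^ (q : ℂ)).prod =
      (‖s.prod‖ ^ q : ℝ) * exp ((q * (s.map arg).sum : ℝ) * I) := by
  induction s using Multiset.induction_on with
  | empty => simp
  | cons x s ih =>
    have hpolar : x ^ (q : ℂ) = (‖x‖ ^ q : ℝ) * exp ((q * arg x : ℝ) * I) := by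
      rw [cpow_ofReal, exp_mul_I, mul_comm q, ofReal_cos, ofReal_sin]
    rw [Multiset.map_cons, Multiset.prod_cons, ih, hpolar, Multiset.prod_cons, norm_mul,
      Real.mul_rpow (norm_nonneg _) (norm_nonneg _), Multiset.map_cons, Multiset.sum_cons, mul_add,
      ofReal_add, add_mul, exp_add, ofReal_mul (‖x‖ ^ q)]
    ring

/-- The linear factors of the reciprocal polynomial of `P`, normalised to be `1` at `0`. Unlike
`z - a`, they have nonnegative real part on the closed unit disc, so that their principal powers and
arguments need no choice of branch; for `‖a‖ = 1` the moduli agree. -/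
noncomputable def reciprocalFactors (P : Polynomial ℂ) (z : ℂ) : Multiset ℂ :=
  P.roots.map fun a => 1 - conj a * z

/-- The branch in the unit disc of the `q`-th power of the reciprocal polynomial of `P`, with the
leading coefficient replaced by its modulus. Its boundary values have modulus `‖P z‖ ^ q`. -/
noncomputable def discRpow (P : Polynomial ℂ) (q : ℝ) (z : ℂ) : ℂ :=
  (‖P.leadingCoeff‖ ^ q : ℝ) * ((reciprocalFactors P z).map fun x => x ^ (q : ℂ)).prod

/-- The argument of `discRpow P 1`, as a sum of principal arguments (hence not reduced mod `2π`). -/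
noncomputable def discArg (P : Polynomial ℂ) (z : ℂ) : ℝ :=
  ((reciprocalFactors P z).map arg).sum

variable {P : Polynomial ℂ} {q : ℝ} {z : ℂ}

theorem norm_one_sub_conj_mul {a : ℂ} (ha : ‖a‖ = 1) (z : ℂ) : ‖1 - conj a * z‖ = ‖z - a‖ := by
  have hunit : conj a * a = 1 := by rw [conj_mul', ha]; simp
  rw [← hunit, ← mul_sub, norm_mul, norm_conj, ha, one_mul, norm_sub_rev]

theorem norm_eval_eq_norm_prod_reciprocalFactors (hP : ∀ a ∈ P.roots, ‖a‖ = 1) (z : ℂ) :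
    ‖P.eval z‖ = ‖P.leadingCoeff‖ * ‖(reciprocalFactors P z).prod‖ := by
  have hnorm (s : Multiset ℂ) : ‖s.prod‖ = (s.map norm).prod := map_multiset_prod normHom s
  rw [(IsAlgClosed.splits P).eval_eq_prod_roots, norm_mul, hnorm, hnorm, reciprocalFactors,
    Multiset.map_map, Multiset.map_map]
  congr 2
  exact Multiset.map_congr rfl fun a ha => (norm_one_sub_conj_mul (hP a ha) z).symm

theorem discRpow_eq_norm_rpow_mul_exp (hP : ∀ a ∈ P.roots, ‖a‖ = 1) (q : ℝ) (z : ℂ) :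
    discRpow P q z = (‖P.eval z‖ ^ q : ℝ) * exp ((q * discArg P z : ℝ) * I) := by
  rw [discRpow, discArg, prod_map_cpow_ofReal, norm_eval_eq_norm_prod_reciprocalFactors hP,
    Real.mul_rpow (norm_nonneg _) (norm_nonneg _), ofReal_mul (_ ^ q), mul_assoc]

theorem continuousOn_discRpow (hq : 0 < q) (hP : ∀ a ∈ P.roots, ‖a‖ ≤ 1) :
    ContinuousOn (discRpow P q) (closedBall 0 1) := by
  refine continuousOn_const.mul ?_
  simp only [reciprocalFactors, Multiset.map_map, Function.comp_apply]
  refine continuousOn_multiset_prod _ fun a ha z hz => ?_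
  have hre := one_sub_re_nonneg (norm_conj_mul_le_one (hP a ha) (by simpa using hz))
  exact ((continuousAt_cpow_const_of_re_pos (w := (q : ℂ)) (Or.inl hre) (by simpa using hq)).comp
    (f := fun z => 1 - conj a * z) (by fun_prop)).continuousWithinAt

theorem differentiableAt_discRpow (q : ℝ) (hP : ∀ a ∈ P.roots, ‖a‖ ≤ 1) (hz : ‖z‖ ≤ 1)
    (hne : ∀ a ∈ P.roots, conj a * z ≠ 1) : DifferentiableAt ℂ (discRpow P q) z := by
  refine (differentiableAt_const _).mul ?_
  simp only [reciprocalFactors, Multiset.map_map, Function.comp_apply]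
  have hfactor : ∀ a ∈ P.roots, DifferentiableAt ℂ (fun z => (1 - conj a * z) ^ (q : ℂ)) z :=
    fun a ha => .cpow (by fun_prop) (by fun_prop)
      (Or.inl (one_sub_re_pos (norm_conj_mul_le_one (hP a ha) hz) (hne a ha)))
  classical
  exact (HasFDerivAt.multiset_prod fun a ha => (hfactor a ha).hasFDerivAt).differentiableAt

theorem diffContOnCl_discRpow (hq : 0 < q) (hP : ∀ a ∈ P.roots, ‖a‖ ≤ 1) :
    DiffContOnCl ℂ (discRpow P q) (ball 0 1) := by
  refine .mk_ball (fun z hz => ?_) (continuousOn_discRpow hq hP)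
  have hz : ‖z‖ < 1 := by simpa using hz
  refine (differentiableAt_discRpow q hP hz.le fun a ha h => ?_).differentiableWithinAt
  have hlt : ‖conj a * z‖ < 1 := by
    simpa using mul_lt_one_of_nonneg_of_lt_one_right (hP a ha) (norm_nonneg z) hz
  simp [h] at hlt

theorem reciprocalFactors_conj (hsymm : P.roots.map conj = P.roots) (z : ℂ) :
    reciprocalFactors P (conj z) = (reciprocalFactors P z).map conj := by
  rw [reciprocalFactors, ← hsymm, reciprocalFactors, Multiset.map_map, Multiset.map_map]
  simp

theorem arg_ne_pi_of_mem_reciprocalFactors (hP : ∀ a ∈ P.roots, ‖a‖ ≤ 1) (hz : ‖z‖ ≤ 1) :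
    ∀ x ∈ reciprocalFactors P z, x.arg ≠ π := by
  simp only [reciprocalFactors, Multiset.mem_map, forall_exists_index, and_imp]
  rintro _ a ha rfl h
  exact (arg_eq_pi_iff.1 h).1.not_ge (one_sub_re_nonneg (norm_conj_mul_le_one (hP a ha) hz))

theorem discRpow_conj (q : ℝ) (hP : ∀ a ∈ P.roots, ‖a‖ ≤ 1) (hsymm : P.roots.map conj = P.roots)
    (hz : ‖z‖ ≤ 1) : discRpow P q (conj z) = conj (discRpow P q z) := by
  have hfactor : ∀ x ∈ reciprocalFactors P z, conj x ^ (q : ℂ) = conj (x ^ (q : ℂ)) :=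
    fun x hx => by
      rw [conj_cpow _ _ (arg_ne_pi_of_mem_reciprocalFactors hP hz x hx), conj_ofReal]
  rw [discRpow, discRpow, reciprocalFactors_conj hsymm, Multiset.map_map, map_mul, conj_ofReal,
    map_multiset_prod, Multiset.map_map]
  exact congrArg _ (congrArg _ (Multiset.map_congr rfl hfactor))

theorem discArg_conj (hP : ∀ a ∈ P.roots, ‖a‖ ≤ 1) (hsymm : P.roots.map conj = P.roots)
    (hz : ‖z‖ ≤ 1) : discArg P (conj z) = -discArg P z := by
  have hfactor : ∀ x ∈ reciprocalFactors P z, (conj x).arg = -x.arg := fun x hx => by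
    rw [arg_conj, if_neg (arg_ne_pi_of_mem_reciprocalFactors hP hz x hx)]
  rw [discArg, discArg, reciprocalFactors_conj hsymm, Multiset.map_map, ← Multiset.sum_map_neg]
  exact congrArg _ (Multiset.map_congr rfl hfactor)

theorem discArg_one (hP : ∀ a ∈ P.roots, ‖a‖ ≤ 1) (hsymm : P.roots.map conj = P.roots) :
    discArg P 1 = 0 := by
  have := discArg_conj hP hsymm (z := 1) norm_one.le
  rw [map_one] at this
  linarith

theorem intervalIntegrable_and_integral_norm_eval_rpow_mul_sin_discArg (hq : 0 < q)
    (hP : ∀ a ∈ P.roots, ‖a‖ = 1) (hsymm : P.roots.map conj = P.roots) (h1 : 1 ∉ P.roots) :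
    IntervalIntegrable (fun θ : ℝ => ‖P.eval (exp (θ * I))‖ ^ q *
        (Real.sin (q * discArg P (exp (θ * I)) + θ / 2) / Real.sin (θ / 2)))
      volume 0 π ∧
    ∫ θ in (0 : ℝ)..π, ‖P.eval (exp (θ * I))‖ ^ q *
        (Real.sin (q * discArg P (exp (θ * I)) + θ / 2) / Real.sin (θ / 2)) =
      π * ‖P.eval 1‖ ^ q := by
  have hP' : ∀ a ∈ P.roots, ‖a‖ ≤ 1 := fun a ha => (hP a ha).le
  have hdiff : DifferentiableAt ℂ (discRpow P q) 1 := by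
    refine differentiableAt_discRpow q hP' norm_one.le fun a ha h => h1 ?_
    rw [mul_one, map_eq_one_iff _ (star_injective (R := ℂ))] at h
    exact h ▸ ha
  have hone : (discRpow P q 1).re = ‖P.eval 1‖ ^ q := by
    simp only [discRpow_eq_norm_rpow_mul_exp hP, discArg_one hP' hsymm, mul_zero, ofReal_zero,
      zero_mul, exp_zero, mul_one, ofReal_re]
  have hboundary (θ : ℝ) :
      (discRpow P q (exp (θ * I)) * exp ((θ / 2 : ℝ) * I)).im / Real.sin (θ / 2) =
        ‖P.eval (exp (θ * I))‖ ^ q *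
          (Real.sin (q * discArg P (exp (θ * I)) + θ / 2) / Real.sin (θ / 2)) := by
    rw [discRpow_eq_norm_rpow_mul_exp hP, mul_assoc, ← exp_add, ← add_mul, ← ofReal_add,
      im_ofReal_mul, exp_ofReal_mul_I_im, mul_div_assoc]
  simpa only [hboundary, hone] using intervalIntegrable_and_integral_im_mul_exp_half_div_sin_half
    (diffContOnCl_discRpow hq hP') hdiff fun z hz => discRpow_conj q hP' hsymm hz.le

/-- A conjugation-invariant multiset of points on the unit circle, listed by the angles `t j` of the
conjugate pairs and the number `m` of extra zeros at `-1`; an angle `t j = π` gives `-1` twice. -/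
noncomputable def conjPairZeros {ι : Type*} (s : Finset ι) (t : ι → ℝ) (m : ℕ) : Multiset ℂ :=
  ∑ j ∈ s, {exp (t j * I), exp (-t j * I)} + Multiset.replicate m (-1)

variable {ι : Type*} {s : Finset ι} {t : ι → ℝ} {m : ℕ}

theorem mem_conjPairZeros {a : ℂ} : a ∈ conjPairZeros s t m ↔
    (∃ j ∈ s, a = exp (t j * I) ∨ a = exp (-t j * I)) ∨ m ≠ 0 ∧ a = -1 := by
  simp [conjPairZeros, Multiset.mem_sum, Multiset.mem_replicate]

theorem norm_eq_one_of_mem_conjPairZeros {a : ℂ} (ha : a ∈ conjPairZeros s t m) : ‖a‖ = 1 := by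
  obtain ⟨j, -, rfl | rfl⟩ | ⟨-, rfl⟩ := mem_conjPairZeros.1 ha
  · exact norm_exp_ofReal_mul_I _
  · exact_mod_cast norm_exp_ofReal_mul_I (-t j)
  · simp

theorem one_notMem_conjPairZeros (ht : ∀ j ∈ s, t j ∈ Ioc 0 π) : 1 ∉ conjPairZeros s t m := by
  have hne {φ : ℝ} (hφ : φ ∈ Ioo 0 (2 * π)) : exp (φ * I) ≠ 1 := by
    rw [← sub_ne_zero, exp_ofReal_mul_I_sub_one]
    simpa [-ofReal_sin] using (sin_half_pos hφ).ne'
  have hmem {j : ι} (hj : j ∈ s) : t j ∈ Ioo 0 (2 * π) :=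
    ⟨(ht j hj).1, by linarith [(ht j hj).2, Real.pi_pos]⟩
  intro h
  obtain ⟨j, hj, h | h⟩ | ⟨-, h⟩ := mem_conjPairZeros.1 h
  · exact hne (hmem hj) h.symm
  · rw [neg_mul, exp_neg, eq_comm, inv_eq_one] at h
    exact hne (hmem hj) h
  · norm_num at h

theorem map_conj_conjPairZeros : (conjPairZeros s t m).map conj = conjPairZeros s t m := by
  simp only [conjPairZeros, Multiset.map_add, Multiset.map_replicate,
    ← Multiset.coe_mapAddMonoidHom, map_sum]
  congr 1
  · refine Finset.sum_congr rfl fun j _ => ?_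
    simpa [← exp_conj] using Multiset.pair_comm _ _
  · simp

theorem arg_one_sub_pair {φ θ : ℝ} (hφ : φ ∈ Ioc 0 π) (hθ : θ ∈ Ioo 0 π) (hne : φ ≠ θ) :
    (1 - conj (exp (φ * I)) * exp (θ * I)).arg + (1 - conj (exp (-φ * I)) * exp (θ * I)).arg =
      θ - if φ < θ then π else 0 := by
  have hsub : conj (exp (φ * I)) * exp (θ * I) = exp ((θ - φ : ℝ) * I) := by
    rw [← exp_conj, ← exp_add]
    simp only [map_mul, conj_ofReal, conj_I, mul_neg, ofReal_sub]
    ring_nf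
  have hadd : conj (exp (-φ * I)) * exp (θ * I) = exp ((θ + φ : ℝ) * I) := by
    rw [← exp_conj, ← exp_add]
    simp only [neg_mul, map_neg, map_mul, conj_ofReal, conj_I, mul_neg, neg_neg, ofReal_add]
    ring_nf
  obtain ⟨hφ0, hφπ⟩ := hφ
  obtain ⟨hθ0, hθπ⟩ := hθ
  rw [hsub, hadd, arg_one_sub_exp_of_pos (φ := θ + φ) ⟨by linarith, by linarith⟩]
  split_ifs with h
  · rw [arg_one_sub_exp_of_pos ⟨by linarith, by linarith⟩]
    ring
  · have : θ < φ := lt_of_le_of_ne (not_lt.1 h) hne.symm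
    rw [arg_one_sub_exp_of_neg ⟨by linarith, by linarith⟩]
    ring

theorem arg_one_sub_conj_neg_one_mul_exp {θ : ℝ} (hθ : θ ∈ Ioo (-π) π) :
    (1 - conj (-1) * exp (θ * I)).arg = θ / 2 := by
  have hshift : conj (-1) * exp (θ * I) = exp ((θ + π : ℝ) * I) := by
    simp [add_mul, exp_add]
  rw [hshift, arg_one_sub_exp_of_pos ⟨by linarith [hθ.1], by linarith [hθ.2]⟩]
  ring

theorem discArg_exp (hroots : P.roots = conjPairZeros s t m) (ht : ∀ j ∈ s, t j ∈ Ioc 0 π) {θ : ℝ}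
    (hθ : θ ∈ Ioo 0 π) (hne : ∀ j ∈ s, t j ≠ θ) :
    discArg P (exp (θ * I)) = (s.card + m / 2 : ℝ) * θ - π * (s.filter (t · < θ)).card := by
  have hpairs : ∑ j ∈ s, ((1 - conj (exp (t j * I)) * exp (θ * I)).arg +
      (1 - conj (exp (-t j * I)) * exp (θ * I)).arg) =
      s.card * θ - π * (s.filter (t · < θ)).card := by
    rw [Finset.sum_congr rfl fun j hj => arg_one_sub_pair (ht j hj) hθ (hne j hj),
      Finset.sum_sub_distrib, ← Finset.sum_filter]
    simp [mul_comm π]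
  have hminus : (1 - conj (-1) * exp (θ * I)).arg = θ / 2 :=
    arg_one_sub_conj_neg_one_mul_exp ⟨by linarith [hθ.1, Real.pi_pos], hθ.2⟩
  rw [discArg, reciprocalFactors, hroots, conjPairZeros, Multiset.map_map, Multiset.map_add,
    Multiset.sum_add, Multiset.map_replicate, Multiset.sum_replicate, Function.comp_apply, hminus,
    ← Multiset.coe_mapAddMonoidHom, map_sum, ← Multiset.coe_sumAddMonoidHom, map_sum]
  simp only [Multiset.coe_mapAddMonoidHom, Multiset.coe_sumAddMonoidHom, Multiset.insert_eq_cons,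
    Multiset.map_cons, Multiset.map_singleton, Multiset.sum_cons, Multiset.sum_singleton,
    Function.comp_apply, hpairs, nsmul_eq_mul]
  ring

theorem intervalIntegrable_and_sum_integral_of_eqOn_Ioo {f : ℕ → ℝ → ℝ} {g : ℝ → ℝ}
    {t : ℕ → ℝ} {N : ℕ} {a b : ℝ} (hg : IntervalIntegrable g volume a b) (ha : t 0 = a)
    (hb : t N = b) (ht : MonotoneOn t (Iic N))
    (hfg : ∀ n < N, EqOn g (f n) (Ioo (t n) (t (n + 1)))) :
    (∀ n < N, IntervalIntegrable (f n) volume (t n) (t (n + 1))) ∧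
      ∑ n ∈ Finset.range N, ∫ x in (t n)..(t (n + 1)), f n x = ∫ x in a..b, g x := by
  subst ha hb
  have hle : ∀ n < N, t n ≤ t (n + 1) := fun n hn => ht hn.le hn n.le_succ
  have hgn : ∀ n < N, IntervalIntegrable g volume (t n) (t (n + 1)) := fun n hn => by
    refine hg.mono_set ?_
    rw [uIcc_of_le (hle n hn), uIcc_of_le (ht N.zero_le self_mem_Iic N.zero_le)]
    exact Icc_subset_Icc (ht N.zero_le hn.le n.zero_le) (ht hn self_mem_Iic hn)
  refine ⟨fun n hn => (hgn n hn).congr_uIoo (uIoo_of_le (hle n hn) ▸ hfg n hn), ?_⟩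
  rw [← intervalIntegral.sum_integral_adjacent_intervals hgn]
  refine Finset.sum_congr rfl fun n hn => ?_
  rw [Finset.mem_range] at hn
  exact (intervalIntegral.integral_congr_Ioo_of_le (hle n hn) (hfg n hn)).symm

theorem monotoneOn_Iic_succ_of_mem_Icc {α : Type*} [Preorder α] {t : ℕ → α} {k : ℕ}
    (hmem : ∀ j ∈ Icc 1 k, t j ∈ Icc (t 0) (t (k + 1))) (h0 : t 0 ≤ t (k + 1))
    (hmono : MonotoneOn t (Icc 1 k)) : MonotoneOn t (Iic (k + 1)) := by
  intro i hi j hj hij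
  rw [mem_Iic] at hi hj
  rcases hij.eq_or_lt with rfl | hlt
  · exact le_rfl
  rcases i.eq_zero_or_pos with rfl | hi0 <;> rcases hj.eq_or_lt with rfl | hjk
  · exact h0
  · exact (hmem j ⟨by lia, by lia⟩).1
  · exact (hmem i ⟨by lia, by lia⟩).2
  · exact hmono ⟨by lia, by lia⟩ ⟨by lia, by lia⟩ hij

theorem lt_iff_le_of_monotoneOn_of_mem_Ioo {α : Type*} [Preorder α] {t : ℕ → α} {N n j : ℕ} {x : α}
    (ht : MonotoneOn t (Iic N)) (hn : n < N) (hj : j ≤ N) (hx : x ∈ Ioo (t n) (t (n + 1))) :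
    t j < x ↔ j ≤ n := by
  refine ⟨fun h => ?_, fun h => (ht hj hn.le h).trans_lt hx.1⟩
  by_contra! hlt
  exact (hx.2.trans_le (ht hn hj hlt)).not_gt h

theorem discArg_exp_of_mem_Ioo {t : ℕ → ℝ} {k n : ℕ}
    (hroots : P.roots = conjPairZeros (Finset.Icc 1 k) t m) (ht0 : t 0 = 0) (htk : t (k + 1) = π)
    (htmem : ∀ j ∈ Finset.Icc 1 k, t j ∈ Ioc 0 π) (ht : MonotoneOn t (Iic (k + 1))) (hn : n ≤ k)
    {θ : ℝ} (hθ : θ ∈ Ioo (t n) (t (n + 1))) :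
    discArg P (exp (θ * I)) = (k + m / 2 : ℝ) * θ - π * n := by
  have hlt {j : ℕ} (hj : j ≤ k + 1) : t j < θ ↔ j ≤ n :=
    lt_iff_le_of_monotoneOn_of_mem_Ioo ht (Nat.lt_succ_of_le hn) hj hθ
  have hne : ∀ j ∈ Finset.Icc 1 k, t j ≠ θ := by
    rintro j hj rfl
    have hjn : n < j := by simpa using (hlt (by grind)).not.1 (lt_irrefl _)
    exact hθ.2.not_ge (ht (by grind) (by grind) hjn)
  have hfilter : (Finset.Icc 1 k).filter (t · < θ) = Finset.Icc 1 n := by grind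
  have hθ' : θ ∈ Ioo 0 π := ⟨ht0 ▸ (hlt (by lia)).2 n.zero_le,
    htk ▸ hθ.2.trans_le (ht (by grind) (by grind) (by lia))⟩
  rw [discArg_exp hroots htmem hθ' hne, hfilter]
  simp

theorem intervalIntegrable_and_sum_integral_of_roots_eq_conjPairZeros {t : ℕ → ℝ} {k : ℕ}
    (hroots : P.roots = conjPairZeros (Finset.Icc 1 k) t m) (ht0 : t 0 = 0) (htk : t (k + 1) = π)
    (htmem : ∀ j ∈ Finset.Icc 1 k, t j ∈ Ioc 0 π) (ht : MonotoneOn t (Iic (k + 1))) (hq : 0 < q) :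
    (∀ n < k + 1, IntervalIntegrable (fun θ : ℝ => ‖P.eval (exp (θ * I))‖ ^ q *
        (Real.sin (((k + m / 2 : ℝ) * q + 1 / 2) * θ - π * q * n) / Real.sin (θ / 2)))
      volume (t n) (t (n + 1))) ∧
    ∑ n ∈ Finset.range (k + 1), ∫ θ in (t n)..(t (n + 1)), ‖P.eval (exp (θ * I))‖ ^ q *
        (Real.sin (((k + m / 2 : ℝ) * q + 1 / 2) * θ - π * q * n) / Real.sin (θ / 2)) =
      π * ‖P.eval 1‖ ^ q := by
  obtain ⟨hint, heq⟩ := intervalIntegrable_and_integral_norm_eval_rpow_mul_sin_discArg hq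
    (fun a ha => norm_eq_one_of_mem_conjPairZeros (hroots ▸ ha))
    (hroots ▸ map_conj_conjPairZeros) (hroots ▸ one_notMem_conjPairZeros htmem)
  rw [← heq]
  refine intervalIntegrable_and_sum_integral_of_eqOn_Ioo hint ht0 htk ht fun n hn θ hθ => ?_
  have harg := discArg_exp_of_mem_Ioo hroots ht0 htk htmem ht (Nat.lt_succ_iff.1 hn) hθ
  rw [harg]
  ring_nf

theorem theorem3p2_general (d : ℕ) (P : Polynomial ℂ) (t : ℕ → ℝ) (ht_zero : t 0 = 0)
    (ht_last : t (d / 2 + 1) = π) (ht_mem : ∀ j ∈ Finset.Icc 1 (d / 2), 0 < t j ∧ t j ≤ π)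
    (ht_mono : MonotoneOn t (Icc 1 (d / 2)))
    (hroots : P.roots =
      (∑ j ∈ Finset.Icc 1 (d / 2), ({exp (t j * I), exp (-t j * I)} : Multiset ℂ)) +
        (if Odd d then {-1} else 0))
    (q : ℝ) (hq : 0 < q) :
    (∀ n ∈ Finset.range (d / 2 + 1), IntervalIntegrable (fun θ : ℝ =>
        ‖P.eval (exp (θ * I))‖ ^ q *
          (Real.sin (((d : ℝ) / 2 * q + 1 / 2) * θ - π * q * n) / Real.sin (θ / 2)))
        volume (t n) (t (n + 1))) ∧
    ‖P.eval 1‖ ^ q =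
      ∑ n ∈ Finset.range (d / 2 + 1), (1 / π) *
        ∫ θ in (t n)..(t (n + 1)), ‖P.eval (exp (θ * I))‖ ^ q *
          (Real.sin (((d : ℝ) / 2 * q + 1 / 2) * θ - π * q * n) / Real.sin (θ / 2)) := by
  have hd : ((d / 2 : ℕ) + (d % 2 : ℕ) / 2 : ℝ) = (d : ℝ) / 2 := by
    have : (2 * (d / 2 : ℕ) + (d % 2 : ℕ) : ℝ) = d := by exact_mod_cast Nat.div_add_mod d 2
    linarith
  have hminus : (if Odd d then {-1} else 0 : Multiset ℂ) = Multiset.replicate (d % 2) (-1) := by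
    rcases Nat.mod_two_eq_zero_or_one d with h | h <;> simp [Nat.odd_iff, h]
  have ht : MonotoneOn t (Iic (d / 2 + 1)) := by
    refine monotoneOn_Iic_succ_of_mem_Icc (fun j hj => ?_) ?_ ht_mono <;> rw [ht_zero, ht_last]
    exacts [Ioc_subset_Icc_self (ht_mem j (Finset.mem_Icc.2 hj)), Real.pi_pos.le]
  obtain ⟨hint, hsum⟩ := intervalIntegrable_and_sum_integral_of_roots_eq_conjPairZeros
    (hroots.trans (congrArg _ hminus)) ht_zero ht_last ht_mem ht hq
  simp only [hd] at hint hsum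
  refine ⟨fun n hn => hint n (Finset.mem_range.1 hn), ?_⟩
  rw [← Finset.mul_sum, hsum, ← mul_assoc, one_div_mul_cancel Real.pi_ne_zero, one_mul]

end

theorem theorem3p2 (d : ℕ) (P : Polynomial ℂ) (hdeg : P.degree = (d : WithBot ℕ))
    (hsymm : ∀ θ : ℝ, P.eval (Complex.exp (θ * Complex.I)) =
      (starRingEnd ℂ) (P.eval (Complex.exp (-θ * Complex.I))))
    (t : ℕ → ℝ) (ht_zero : t 0 = 0) (ht_last : t (d / 2 + 1) = Real.pi)
    (ht_mem : ∀ j ∈ Finset.Icc 1 (d / 2), 0 < t j ∧ t j ≤ Real.pi)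
    (ht_mono : MonotoneOn t (Set.Icc 1 (d / 2)))
    -- the zeros of `P`, listed with multiplicity
    (hroots : P.roots =
      (∑ j ∈ Finset.Icc 1 (d / 2),
        ({Complex.exp (t j * Complex.I), Complex.exp (-t j * Complex.I)} : Multiset ℂ)) +
      (if Odd d then {-1} else 0))
    (q : ℝ) (hq : 0 < q) :
    (∀ n ∈ Finset.range (d / 2 + 1),
      IntervalIntegrable (fun θ : ℝ => ‖P.eval (Complex.exp (θ * Complex.I))‖ ^ q *
        (Real.sin (((d : ℝ) / 2 * q + 1 / 2) * θ - Real.pi * q * n) / Real.sin (θ / 2)))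
        MeasureTheory.volume (t n) (t (n + 1))) ∧
    ‖P.eval 1‖ ^ q =
      ∑ n ∈ Finset.range (d / 2 + 1), (1 / Real.pi) *
        ∫ θ in (t n)..(t (n + 1)), ‖P.eval (Complex.exp (θ * Complex.I))‖ ^ q *
          (Real.sin (((d : ℝ) / 2 * q + 1 / 2) * θ - Real.pi * q * n) / Real.sin (θ / 2)) :=
  theorem3p2_general d P t ht_zero ht_last ht_mem ht_mono hroots q hq
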